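/- Conventions. An orientation of an undirected graph $G$ is a digraph $D$ on the same vertex set such that, for all vertices $a,b$, there is an arc between $a$ and $b$ if and only if $ab$ is an edge of $G$, and then in exactly one of the two directions. $G[W]$ and $D[W]$ denote induced subgraphs, $\chi$ the chromatic number (a cardinal), $K_\kappa$ the complete graph on the vertex set $\kappa$, and $\vec C_n$ the directed cycle with $n$ vertices; a digraph contains $\vec C_n$ if $\vec C_n$ embeds into it as a not necessarily induced subgraph. $[X]^{\kappa}$ is the set of subsets of $X$ of size $\kappa$, and $\kappa\nrightarrow[\kappa;\kappa]^2_2$ means that there is $f:[\kappa]^2\to 2$ such that for all $A,B\in[\kappa]^\kappa$ and $i<2$ there are $\alpha\in A$ and $\beta\in B$ with $\alpha<\beta$ and $f(\{\alpha,\beta\})=i$. Theorem. (1) Let $\kappa$ be an infinite regular cardinal with $\kappa\nrightarrow[\kappa;\kappa]^2_2$. Then $K_\kappa$ has an orientation $D$ such that for every $W\subseteq\kappa$ with $\chi(K_\kappa[W])=\chi(K_\kappa)$ (that is, with $|W|=\kappa$) and every integer $n\ge 3$, the digraph $D[W]$ contains $\vec C_n$. (2) Let $\lambda$ be an uncountable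 cardinal. Then $K_{\lambda^+}$ has an orientation $D$ such that for every colouring $c:\lambda^+\to\lambda$ of the vertices there is a single colour $i<\lambda$ such that $D[c^{-1}(i)]$ contains $\vec C_n$ for every integer $n\ge 3$. -/

import Mathlib

open Cardinal

universe u

namespace DirectedColouring

/-- `D` is an orientation of the undirected graph `G`: the vertices `a`, `b` are joined by an arc of
`D` if and only if `ab` is an edge of `G`, and never in both directions (so `D` has no loops). -/
def IsOrientation {V : Type*} (D : Digraph V) (G : SimpleGraph V) : Prop :=
  (∀ a b, G.Adj a b ↔ D.Adj a b ∨ D.Adj b a) ∧ ∀ a b, D.Adj a b → ¬ D.Adj b a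

/-- The induced subdigraph `D[W]`. -/
def inducedDigraph {V : Type*} (D : Digraph V) (W : Set V) : Digraph W where
  Adj a b := D.Adj a b

/-- `D₀` embeds into `D` as a (not necessarily induced) subgraph. -/
def Embeds {V₀ V : Type*} (D₀ : Digraph V₀) (D : Digraph V) : Prop :=
  ∃ f : V₀ → V, Function.Injective f ∧ ∀ a b, D₀.Adj a b → D.Adj (f a) (f b)

/-- The directed cycle `0 → 1 → ⋯ → n - 1 → 0` on `n` vertices (used for `n ≥ 3`). -/
def directedCycle (n : ℕ) : Digraph (Fin n) where
  Adj i j := (j : ℕ) = ((i : ℕ) + 1) % n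

/-- The chromatic number of `G` as a cardinal: the least size of a set of colours that admits a
proper colouring of the vertices of `G`. -/
noncomputable def cardChromaticNumber {V : Type u} (G : SimpleGraph V) : Cardinal.{u} :=
  sInf {c : Cardinal.{u} | ∃ C : Type u, #C = c ∧ Nonempty (G.Coloring C)}

/-- The complete graph `K_κ`, on the vertex set `κ`. -/
abbrev completeGraphOn (κ : Cardinal.{u}) : SimpleGraph κ.ord.ToType := ⊤

/-- The strong relation: `G` has an orientation `D` such that, whenever `χ(G[W]) = χ(G)`,
every member of the family `𝒟` embeds into `D[W]`. -/
def OrientsStronglyAll {V : Type u} (G : SimpleGraph V) {ι : Type} {X : ι → Type}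
    (𝒟 : ∀ i, Digraph (X i)) : Prop :=
  ∃ D : Digraph V, IsOrientation D G ∧
    ∀ W : Set V, cardChromaticNumber (G.induce W) = cardChromaticNumber G →
      ∀ i, Embeds (𝒟 i) (inducedDigraph D W)

/-- The relation with `r` colours: `G` has an orientation `D` such that, for every colouring of the
vertices with `r` colours, there is a colour class into which every member of the family `𝒟`
embeds (one colour class that serves all members of the family). -/
def OrientsAll {V : Type u} (G : SimpleGraph V) {ι : Type} {X : ι → Type}
    (𝒟 : ∀ i, Digraph (X i)) (r : Cardinal.{u}) : Prop :=
  ∃ D : Digraph V, IsOrientation D G ∧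
    ∀ (C : Type u), #C = r → ∀ c : V → C,
      ∃ k : C, ∀ i, Embeds (𝒟 i) (inducedDigraph D {v | c v = k})

/-- The family of the directed cycles with `n ≥ 3` vertices. -/
def directedCycles (n : {n : ℕ // 3 ≤ n}) : Digraph (Fin n) := directedCycle n

/-- `κ ↛ [κ; κ]²₂`: there is a colouring `f` of the (unordered) pairs from `κ` with two colours such
that for all `A, B ⊆ κ` of size `κ` each colour is attained as `f {α, β}` with `α ∈ A`, `β ∈ B`
and `α < β`. The values of `f` on the diagonal of `Sym2` play no role. -/
def NotArrowRect (κ : Cardinal.{u}) : Prop :=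
  ∃ f : Sym2 κ.ord.ToType → Fin 2,
    ∀ A B : Set κ.ord.ToType, #A = κ → #B = κ →
      ∀ i : Fin 2, ∃ α ∈ A, ∃ β ∈ B, α < β ∧ f s(α, β) = i

end DirectedColouring

namespace DirectedColouring

open Set

/-! Both orientations come from a relation `r` on pairs `a < b`, and `embeds_of_isPositive` finds
the cycles. Suppose `r` and its negation each occur between any unbounded `A` and any positive `B`.
After removing a bounded part, every vertex of a positive `W` has unboundedly many upper neighbours
of either kind. Fix `v` in `W`: the points `b` with `¬ r v b`, or those with `r v b`, form a
positive set. In the first case the ends of `r`-paths of a given length from `v` are unbounded, so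
some such path extends to a `b` whose arc returns to `v`. The second case is symmetric, with the
cycle traversed backwards.

In (1), positive means of size `κ`. In (2), `r a δ` is the parity of the part up to `a` of an
`ω`-sequence converging to `δ`. Club guessing (`exists_guessing`, available since `λ⁺ > ℵ₁`) puts
such a sequence inside any given club. Positive sets are those whose points `δ` suffice for
guessing; the corresponding ideal is `λ⁺`-complete, so some colour class is positive. -/

/-- A subset of a linear order that is not bounded above, in strict form. -/
def Unbounded {T : Type u} [LinearOrder T] (A : Set T) : Prop := ∀ x, ∃ a ∈ A, x < a

/-- Families of fewer than `κ` elements of `T` have a strict upper bound. -/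
def SmallBounded (κ : Cardinal.{u}) (T : Type u) [LinearOrder T] : Prop :=
  ∀ ⦃ι : Type u⦄, #ι < κ → ∀ F : ι → T, ∃ b, ∀ i, F i < b

theorem smallBounded_ord {κ : Cardinal.{u}} (hκ : κ.IsRegular) : SmallBounded κ κ.ord.ToType := by
  intro ι hι F
  have h : ¬ IsCofinal (range F) := by
    intro hc
    have h1 := Order.cof_le hc
    rw [Ordinal.cof_toType, hκ.cof_ord] at h1
    exact absurd (h1.trans mk_range_le) (not_le.2 hι)
  rw [IsCofinal] at h
  push Not at h
  obtain ⟨b, hb⟩ := h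
  exact ⟨b, fun i => hb _ ⟨i, rfl⟩⟩

theorem mk_Iio_ord_lt {κ : Cardinal.{u}} (x : κ.ord.ToType) : #(Iio x) < κ :=
  (mk_Iio_lt x (by simp)).trans_eq (by simp)

theorem mk_Iic_ord_lt {κ : Cardinal.{u}} (hκ : ℵ₀ ≤ κ) (x : κ.ord.ToType) : #(Iic x) < κ := by
  have := Cardinal.noMaxOrder hκ
  obtain ⟨y, hy⟩ := exists_gt x
  exact (mk_le_mk_of_subset (Iic_subset_Iio.2 hy)).trans_lt (mk_Iio_ord_lt y)

/-- Transfinite recursion along a well-founded relation, keeping only a binary requirement. -/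
theorem exists_rec {Ω : Type*} [LinearOrder Ω] [WellFoundedLT Ω] {X : Type*} (R : X → X → Prop)
    (h : ∀ (ξ : Ω) (prev : Iio ξ → X), ∃ x, ∀ η, R (prev η) x) :
    ∃ G : Ω → X, ∀ η ξ, η < ξ → R (G η) (G ξ) := by
  choose next hnext using h
  let G : Ω → X := (wellFounded_lt (α := Ω)).fix fun ξ prev => next ξ fun η => prev η.1 η.2
  refine ⟨G, fun η ξ hηξ => ?_⟩
  have hG : G ξ = next ξ fun η => G η.1 := (wellFounded_lt (α := Ω)).fix_eq _ ξ
  rw [hG]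
  exact hnext ξ (fun η => G η.1) ⟨η, hηξ⟩

/-! ### Directed cycles in tournaments coming from a relation on a linear order -/

/-- The tournament on a linear order that directs `a < b` upwards exactly when `r a b` holds. -/
def tournament {T : Type u} [LinearOrder T] (r : T → T → Prop) : Digraph T where
  Adj a b := (a < b ∧ r a b) ∨ (b < a ∧ ¬ r b a)

theorem isOrientation_tournament {T : Type u} [LinearOrder T] (r : T → T → Prop) :
    IsOrientation (tournament r) (⊤ : SimpleGraph T) := by
  constructor
  · intro a b
    simp only [SimpleGraph.top_adj, tournament]
    rcases lt_trichotomy a b with h | rfl | h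
    · simp [h, h.ne, h.not_gt, em]
    · simp
    · simp [h, h.ne', h.not_gt, em']
  · intro a b hab hba
    rcases hab with h | h <;> rcases hba with h' | h'
    · exact h.1.not_gt h'.1
    · exact h'.2 h.2
    · exact h.2 h'.2
    · exact h.1.not_gt h'.1

theorem embeds_directedCycle {T : Type u} {D : Digraph T} {W : Set T} {n : ℕ} (hn : 3 ≤ n)
    (q : ℕ → T) (hW : ∀ i < n, q i ∈ W) (hinj : ∀ i < n, ∀ j < n, q i = q j → i = j)
    (hq : ∀ i, i + 1 < n → D.Adj (q i) (q (i + 1))) (hlast : D.Adj (q (n - 1)) (q 0)) :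
    Embeds (directedCycle n) (inducedDigraph D W) := by
  refine ⟨fun i => ⟨q i, hW i i.2⟩, ?_, ?_⟩
  · intro i j hij
    exact Fin.ext (hinj i i.2 j j.2 (congrArg Subtype.val hij))
  · intro i j hij
    have hij' : (j : ℕ) = ((i : ℕ) + 1) % n := hij
    change D.Adj (q i) (q j)
    by_cases h : (i : ℕ) + 1 < n
    · rw [hij', Nat.mod_eq_of_lt h]
      exact hq i h
    · have hi : (i : ℕ) = n - 1 := by omega
      have h0 : ((i : ℕ) + 1) % n = 0 := by
        rw [show (i : ℕ) + 1 = n by omega, Nat.mod_self]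
      rw [hij', h0, hi]
      exact hlast

/-- An increasing path of `n` arcs in `W` along `r`. -/
structure IsPath {T : Type u} [LinearOrder T] (r : T → T → Prop) (W : Set T) (n : ℕ)
    (p : ℕ → T) : Prop where
  mem : ∀ k ≤ n, p k ∈ W
  lt : ∀ k < n, p k < p (k + 1)
  rel : ∀ k < n, r (p k) (p (k + 1))

namespace IsPath

variable {T : Type u} [LinearOrder T] {r : T → T → Prop} {W : Set T} {n : ℕ} {p : ℕ → T}

theorem strictMonoOn (hp : IsPath r W n p) : ∀ i j, i < j → j ≤ n → p i < p j := by
  intro i j hij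
  induction j, hij using Nat.le_induction with
  | base => exact fun h => hp.lt i h
  | succ j _ ih => exact fun h => (ih (by omega)).trans (hp.lt j h)

theorem injOn (hp : IsPath r W n p) : ∀ i ≤ n, ∀ j ≤ n, p i = p j → i = j := by
  intro i hi j hj hij
  rcases lt_trichotomy i j with h | h | h
  · exact absurd hij (hp.strictMonoOn i j h hj).ne
  · exact h
  · exact absurd hij (hp.strictMonoOn j i h hi).ne'

theorem extend (hp : IsPath r W n p) {b : T} (hb : b ∈ W) (hlt : p n < b) (hr : r (p n) b) :
    IsPath r W (n + 1) (Function.update p (n + 1) b) := by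
  have hne : ∀ k ≤ n, Function.update p (n + 1) b k = p k := fun k hk =>
    Function.update_of_ne (by omega) _ _
  refine ⟨fun k hk => ?_, fun k hk => ?_, fun k hk => ?_⟩
  · rcases Nat.lt_or_eq_of_le hk with h | rfl
    · rw [hne k (by omega)]
      exact hp.mem k (by omega)
    · simpa using hb
  all_goals
    rw [hne k (by omega)]
    rcases Nat.lt_or_eq_of_le (Nat.le_of_lt_succ hk) with h | rfl
    · rw [hne _ h]
      first | exact hp.lt k h | exact hp.rel k h
    · simpa

end IsPath

section Cycles

variable {T : Type u} [LinearOrder T]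

theorem exists_long_path {r : T → T → Prop} {W : Set T}
    (hr : ∀ v ∈ W, Unbounded {b | b ∈ W ∧ r v b}) {v : T} (hv : v ∈ W) (n : ℕ) :
    -- At least one arc is needed: a path without arcs ends only at `v`.
    Unbounded {b | ∃ p, IsPath r W (n + 1) p ∧ p 0 = v ∧ p (n + 1) = b} := by
  have step : ∀ m p, IsPath r W m p → p 0 = v →
      Unbounded {b | ∃ p, IsPath r W (m + 1) p ∧ p 0 = v ∧ p (m + 1) = b} := by
    intro m p hp h0 x
    obtain ⟨b, ⟨hbW, hb⟩, hlt⟩ := hr (p m) (hp.mem m le_rfl) (max x (p m))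
    refine ⟨b, ⟨_, hp.extend hbW ((le_max_right _ _).trans_lt hlt) hb, ?_, by simp⟩,
      (le_max_left _ _).trans_lt hlt⟩
    rw [Function.update_of_ne (by omega), h0]
  induction n with
  | zero => exact step 0 (fun _ => v) ⟨fun _ _ => hv, by simp, by simp⟩ rfl
  | succ n ih =>
    obtain ⟨_, ⟨p, hp, h0, _⟩, _⟩ := ih v
    exact step (n + 1) p hp h0

/-- A relation `r` on a linear order that is attained on all rectangles with an unbounded side and
a side from the family `P`, even above the values of a given function `g`. -/
def Attained (P : Set T → Prop) (r : T → T → Prop) : Prop :=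
  ∀ A B : Set T, Unbounded A → P B → ∀ g : T → T, ∃ a ∈ A, ∃ b ∈ B, a < b ∧ g a < b ∧ r a b

/-- The complement of a proper ideal that contains the bounded sets. -/
structure IsPositive (P : Set T → Prop) : Prop where
  mono : ∀ {X Y : Set T}, P X → X ⊆ Y → P Y
  or_of_union : ∀ {X Y : Set T}, P (X ∪ Y) → P X ∨ P Y
  unbounded : ∀ {X : Set T}, P X → Unbounded X

variable {P : Set T → Prop}

theorem IsPositive.inter_Ioi (hP : IsPositive P) {W : Set T} (hW : P W) (b : T) :
    P (W ∩ Ioi b) := by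
  have h : P (W ∩ Ioi b ∪ Iic b) := hP.mono hW fun x hx =>
    (lt_or_ge b x).imp (fun h => ⟨hx, h⟩) id
  refine (hP.or_of_union h).resolve_right fun h' => ?_
  obtain ⟨a, ha, hba⟩ := hP.unbounded h' b
  exact absurd hba (not_lt.2 ha)

/-- Otherwise the vertices with bounded `r`-neighbourhood in `W` are unbounded; taking `g` to be
those bounds contradicts `Attained`. -/
theorem Attained.exists_bound {r : T → T → Prop} (hr : Attained P r) {W : Set T}
    (hW : P W) : ∃ x, ∀ v ∈ W, x < v → Unbounded {b | b ∈ W ∧ r v b} := by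
  by_contra! hcon
  have hA : Unbounded {v | ∃ x, ∀ b ∈ W, r v b → b ≤ x} := by
    intro x
    obtain ⟨v, _, hxv, hv⟩ := hcon x
    refine ⟨v, ?_, hxv⟩
    simp only [Unbounded] at hv
    push Not at hv
    obtain ⟨y, hy⟩ := hv
    exact ⟨y, fun b hb hvb => hy b ⟨hb, hvb⟩⟩
  have hg : ∀ v, ∃ x, (∃ x, ∀ b ∈ W, r v b → b ≤ x) → ∀ b ∈ W, r v b → b ≤ x := by
    intro v
    by_cases h : ∃ x, ∀ b ∈ W, r v b → b ≤ x
    · exact ⟨h.choose, fun _ => h.choose_spec⟩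
    · exact ⟨v, fun h' => absurd h' h⟩
  choose g hg using hg
  obtain ⟨a, ha, b, hb, _, hgb, hab⟩ := hr _ W hA hW g
  exact absurd (hg a ha b hb hab) (not_le.2 hgb)

theorem exists_closed_path {r : T → T → Prop} (hr : Attained P r) {W : Set T}
    (hW : ∀ v ∈ W, Unbounded {b | b ∈ W ∧ r v b}) {v : T} (hv : v ∈ W)
    (hpos : P {b | b ∈ W ∧ ¬ r v b}) (n : ℕ) :
    ∃ p, IsPath r W (n + 2) p ∧ ¬ r (p 0) (p (n + 2)) := by
  obtain ⟨a, ⟨p, hp, h0, rfl⟩, b, ⟨hbW, hb⟩, hlt, _, hab⟩ :=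
    hr _ _ (exists_long_path hW hv n) hpos id
  refine ⟨_, hp.extend hbW hlt hab, ?_⟩
  rw [Function.update_of_ne (by omega)]
  simpa [h0] using hb

theorem embeds_of_isPositive (hP : IsPositive P) {r : T → T → Prop} (hr : Attained P r)
    (hr' : Attained P fun a b => ¬ r a b) {W : Set T} (hW : P W) {n : ℕ} (hn : 3 ≤ n) :
    Embeds (directedCycle n) (inducedDigraph (tournament r) W) := by
  obtain ⟨x, hx⟩ := hr.exists_bound hW
  obtain ⟨y, hy⟩ := hr'.exists_bound hW
  set V := W ∩ Ioi (max x y) with hV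
  have hVW : V ⊆ W := inter_subset_left
  have hVP : P V := hP.inter_Ioi hW _
  have restrict : ∀ s : T → Prop, Unbounded {b | b ∈ W ∧ s b} → Unbounded {b | b ∈ V ∧ s b} := by
    intro s hs z
    obtain ⟨b, ⟨hbW, hb⟩, hlt⟩ := hs (max (max x y) z)
    exact ⟨b, ⟨⟨hbW, (le_max_left _ _).trans_lt hlt⟩, hb⟩, (le_max_right _ _).trans_lt hlt⟩
  have hV1 : ∀ v ∈ V, Unbounded {b | b ∈ V ∧ r v b} := fun v hv =>
    restrict _ (hx v hv.1 ((le_max_left _ _).trans_lt hv.2))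
  have hV2 : ∀ v ∈ V, Unbounded {b | b ∈ V ∧ ¬ r v b} := fun v hv =>
    restrict _ (hy v hv.1 ((le_max_right _ _).trans_lt hv.2))
  obtain ⟨v, hv, _⟩ := hP.unbounded hVP x
  obtain ⟨m, rfl⟩ : ∃ m, n = m + 3 := ⟨n - 3, by omega⟩
  have hsplit : P ({b | b ∈ V ∧ ¬ r v b} ∪ {b | b ∈ V ∧ r v b}) := hP.mono hVP fun b hb =>
    (em (r v b)).elim (fun h => Or.inr ⟨hb, h⟩) fun h => Or.inl ⟨hb, h⟩
  rcases hP.or_of_union hsplit with h | h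
  · obtain ⟨p, hp, hlast⟩ := exists_closed_path hr hV1 hv h m
    refine embeds_directedCycle hn p (fun i hi => hVW (hp.mem i (by omega)))
      (fun i hi j hj => hp.injOn i (by omega) j (by omega))
      (fun i hi => Or.inl ⟨hp.lt i (by omega), hp.rel i (by omega)⟩)
      (Or.inr ⟨hp.strictMonoOn 0 (m + 2) (by omega) le_rfl, hlast⟩)
  · obtain ⟨p, hp, hlast⟩ := exists_closed_path hr' hV2 hv (by simpa only [not_not] using h) m
    refine embeds_directedCycle hn (fun i => p (m + 2 - i)) (fun i hi => hVW (hp.mem _ (by omega)))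
      (fun i hi j hj hij => ?_) (fun i hi => Or.inr ?_) (Or.inl ?_)
    · have := hp.injOn _ (by omega) _ (by omega) hij
      omega
    · have h1 := hp.lt (m + 2 - (i + 1)) (by omega)
      have h2 := hp.rel (m + 2 - (i + 1)) (by omega)
      rw [show m + 2 - (i + 1) + 1 = m + 2 - i by omega] at h1 h2
      exact ⟨h1, h2⟩
    · have h1 := hp.strictMonoOn 0 (m + 2) (by omega) le_rfl
      simpa using ⟨h1, not_not.1 hlast⟩

end Cycles

/-! ### Complete graphs on regular cardinals with a negative rectangular relation -/

theorem cardChromaticNumber_top (V : Type u) : cardChromaticNumber (⊤ : SimpleGraph V) = #V := by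
  refine le_antisymm (csInf_le' ⟨V, rfl, ⟨SimpleGraph.Coloring.mk id fun h => h⟩⟩) ?_
  refine le_csInf ⟨#V, V, rfl, ⟨SimpleGraph.Coloring.mk id fun h => h⟩⟩ ?_
  rintro _ ⟨C, rfl, ⟨c⟩⟩
  exact mk_le_of_injective (f := c) fun a b hab => by
    by_contra hne
    exact c.valid ((SimpleGraph.top_adj a b).2 hne) hab

theorem cardChromaticNumber_induce_top {V : Type u} (W : Set V) :
    cardChromaticNumber ((⊤ : SimpleGraph V).induce W) = #W := by
  have h : (⊤ : SimpleGraph V).induce W = ⊤ := by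
    ext a b
    simp [Subtype.ext_iff]
  rw [h, cardChromaticNumber_top]

theorem isPositive_mk_eq {κ : Cardinal.{u}} (hκ : ℵ₀ ≤ κ) :
    IsPositive fun X : Set κ.ord.ToType => #X = κ where
  mono := fun {X Y} hX hXY =>
    le_antisymm ((mk_set_le Y).trans (by simp)) (hX.symm.le.trans (mk_le_mk_of_subset hXY))
  or_of_union := by
    intro X Y h
    by_contra! hcon
    have hlt : ∀ Z : Set κ.ord.ToType, #Z ≠ κ → #Z < κ := fun Z hZ =>
      lt_of_le_of_ne ((mk_set_le Z).trans (by simp)) hZ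
    exact absurd h ((mk_union_le X Y).trans_lt
      (add_lt_of_lt hκ (hlt X hcon.1) (hlt Y hcon.2))).ne
  unbounded := by
    intro X hX x
    by_contra! hcon
    exact absurd hX ((mk_le_mk_of_subset (t := Iic x) hcon).trans_lt (mk_Iic_ord_lt hκ x)).ne

/-- The function `g` is absorbed by thinning to `κ` consecutive pairs `a_ξ < b_ξ` with `g a_ξ <
b_ξ`: if `a_ξ < b_η`, then `ξ ≤ η`, so `g a_ξ < b_ξ ≤ b_η`. -/
theorem attained_of_rect {κ : Cardinal.{u}} (hκ : κ.IsRegular)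
    {r : κ.ord.ToType → κ.ord.ToType → Prop}
    (hr : ∀ A B : Set κ.ord.ToType, #A = κ → #B = κ → ∃ a ∈ A, ∃ b ∈ B, a < b ∧ r a b) :
    Attained (fun X : Set κ.ord.ToType => #X = κ) r := by
  intro A B hA hB g
  have hB := (isPositive_mk_eq hκ.aleph0_le).unbounded hB
  obtain ⟨G, hG⟩ := exists_rec (Ω := κ.ord.ToType)
    (X := {p : κ.ord.ToType × κ.ord.ToType // p.1 ∈ A ∧ p.2 ∈ B ∧ p.1 < p.2 ∧ g p.1 < p.2})
    (fun p q => p.1.2 < q.1.1) (by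
      intro ξ prev
      obtain ⟨x, hx⟩ := smallBounded_ord hκ (mk_Iio_ord_lt ξ) fun η => (prev η).1.2
      obtain ⟨a, haA, ha⟩ := hA x
      obtain ⟨b, hbB, hb⟩ := hB (max a (g a))
      exact ⟨⟨(a, b), haA, hbB, (le_max_left _ _).trans_lt hb, (le_max_right _ _).trans_lt hb⟩,
        fun η => (hx η).trans ha⟩)
  have h1 : StrictMono fun ξ => (G ξ).1.1 := fun η ξ h => (G η).2.2.2.1.trans (hG η ξ h)
  have h2 : StrictMono fun ξ => (G ξ).1.2 := fun η ξ h => (hG η ξ h).trans (G ξ).2.2.2.1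
  obtain ⟨_, ⟨ξ, rfl⟩, _, ⟨η, rfl⟩, hlt, hrel⟩ := hr (range fun ξ => (G ξ).1.1)
    (range fun ξ => (G ξ).1.2) (by rw [mk_range_eq _ h1.injective]; simp)
    (by rw [mk_range_eq _ h2.injective]; simp)
  refine ⟨_, (G ξ).2.1, _, (G η).2.2.1, hlt, ?_, hrel⟩
  have hξη : ξ ≤ η := by
    by_contra! h
    exact (hG η ξ h).not_gt hlt
  exact (G ξ).2.2.2.2.trans_le (h2.monotone hξη)

theorem orientsStronglyAll_directedCycles {κ : Cardinal.{u}} (hκ : κ.IsRegular)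
    (h : NotArrowRect κ) : OrientsStronglyAll (completeGraphOn κ) directedCycles := by
  obtain ⟨f, hf⟩ := h
  refine ⟨tournament fun a b => f s(a, b) = 0, isOrientation_tournament _, fun W hW n => ?_⟩
  rw [cardChromaticNumber_induce_top, cardChromaticNumber_top, mk_ord_toType] at hW
  refine embeds_of_isPositive (isPositive_mk_eq hκ.aleph0_le)
    (attained_of_rect hκ fun A B hA hB => hf A B hA hB 0)
    (attained_of_rect hκ fun A B hA hB => ?_) hW n.2
  obtain ⟨a, ha, b, hb, hab, h1⟩ := hf A B hA hB 1
  exact ⟨a, ha, b, hb, hab, by simp [h1]⟩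

/-! ### Club guessing at points of countable cofinality

Closed unbounded sets are represented by the sets of closure points of functions. -/

/-- The points closed under `g`. -/
def closurePoints {T : Type u} [LinearOrder T] (g : T → T) : Set T := {e | ∀ a < e, g a < e}

/-- `l` is a cofinal sequence below `δ`. -/
structure IsLadder {T : Type u} [LinearOrder T] (l : ℕ → T) (δ : T) : Prop where
  mono : Monotone l
  lt : ∀ n, l n < δ
  cofinal : ∀ a < δ, ∃ n, a < l n

/-- `δ` is a limit point of `E`. -/
def IsLimitOf {T : Type u} [LinearOrder T] (E : Set T) (δ : T) : Prop :=
  ∀ a < δ, ∃ e ∈ E, a < e ∧ e < δ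

section Guessing

variable {T : Type u} [LinearOrder T]

theorem closurePoints_anti {g h : T → T} (hgh : ∀ a, g a ≤ h a) :
    closurePoints h ⊆ closurePoints g := fun _ he a ha => (hgh a).trans_lt (he a ha)

variable [WellFoundedLT T]

/-- The supremum of closure points is a closure point; if there are none to take, it is the least
element, which is one vacuously. -/
theorem exists_isGreatest_closurePoints (g : T → T) (x : T) :
    ∃ e, IsGreatest (closurePoints g ∩ Iic x) e := by
  obtain ⟨e, he, hmin⟩ := wellFounded_lt.has_min (upperBounds (closurePoints g ∩ Iic x))
    ⟨x, fun y hy => hy.2⟩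
  refine ⟨e, ⟨fun a ha => ?_, not_lt.1 (hmin x fun y hy => hy.2)⟩, he⟩
  have : a ∉ upperBounds (closurePoints g ∩ Iic x) := fun h => hmin a h ha
  simp only [upperBounds, mem_ofPred_eq] at this
  push Not at this
  obtain ⟨b, hb, hab⟩ := this
  exact (hb.1 a hab).trans_le (he hb)

/-- The largest closure point of `g` that is at most `x`. -/
noncomputable def project (g : T → T) (x : T) : T := (exists_isGreatest_closurePoints g x).choose

theorem isGreatest_project (g : T → T) (x : T) :
    IsGreatest (closurePoints g ∩ Iic x) (project g x) :=
  (exists_isGreatest_closurePoints g x).choose_spec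

theorem project_anti {g h : T → T} (hgh : ∀ a, g a ≤ h a) (x : T) : project h x ≤ project g x :=
  (isGreatest_project g x).2
    ⟨closurePoints_anti hgh (isGreatest_project h x).1.1, (isGreatest_project h x).1.2⟩

variable {κ : Cardinal.{u}}

omit [WellFoundedLT T] in
theorem SmallBounded.countable (hT : SmallBounded κ T) (hκ : ℵ₀ < κ) (F : ℕ → T) :
    ∃ b, ∀ n, F n < b := by
  obtain ⟨b, hb⟩ := hT (ι := ULift.{u} ℕ) (by simpa using hκ) fun n => F n.down
  exact ⟨b, fun n => hb ⟨n⟩⟩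

theorem exists_ladder (hT : SmallBounded κ T) (hκ : ℵ₀ < κ) (h : T → T) (hh : ∀ a, a < h a)
    (a : T) : ∃ δ, a < δ ∧ IsLadder (fun n => h^[n] a) δ := by
  obtain ⟨b, hb⟩ := hT.countable hκ fun n => h^[n] a
  obtain ⟨δ, hδ, hmin⟩ := wellFounded_lt.has_min {δ | ∀ n, h^[n] a < δ} ⟨b, hb⟩
  refine ⟨δ, hδ 0, monotone_nat_of_le_succ fun n => ?_, hδ, fun x hx => ?_⟩
  · rw [Function.iterate_succ_apply']
    exact (hh _).le
  · have : ¬ ∀ n, h^[n] a < x := fun h' => hmin x h' hx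
    push Not at this
    obtain ⟨n, hn⟩ := this
    refine ⟨n + 1, hn.trans_lt ?_⟩
    rw [Function.iterate_succ_apply']
    exact hh _

theorem unbounded_closurePoints (hT : SmallBounded κ T) (hκ : ℵ₀ < κ)
    (hI : ∀ x : T, #(Iic x) < κ) (g : T → T) : Unbounded (closurePoints g) := by
  intro a
  have hstep : ∀ x : T, ∃ y, x < y ∧ ∀ z ≤ x, g z < y := by
    intro x
    obtain ⟨b, hb⟩ := hT (hI x) fun z => g z.1
    obtain ⟨c, hc⟩ := hT.countable hκ fun _ => max x b
    exact ⟨c, (le_max_left _ _).trans_lt (hc 0),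
      fun z hz => (hb ⟨z, hz⟩).trans ((le_max_right _ _).trans_lt (hc 0))⟩
  choose h hlt hg using hstep
  obtain ⟨δ, haδ, hδ⟩ := exists_ladder hT hκ h hlt a
  refine ⟨δ, fun x hx => ?_, haδ⟩
  obtain ⟨n, hn⟩ := hδ.cofinal x hx
  have h1 := hδ.lt (n + 1)
  simp only [Function.iterate_succ_apply'] at h1
  exact (hg _ x hn.le).trans h1

/-- Club guessing for `ω`-ladders: after projection to a suitable closed unbounded set, a ladder
system guesses every closed unbounded set. -/
theorem exists_guessing (hT : SmallBounded κ T) (hκ : ℵ₁ < κ) (hI : ∀ x : T, #(Iic x) < κ)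
    (L : T → ℕ → T) (hL : ∀ δ, (∃ l, IsLadder l δ) → IsLadder (L δ) δ) :
    ∃ g : T → T, ∀ g' : T → T, ∃ δ, IsLadder (L δ) δ ∧ IsLimitOf (closurePoints g) δ ∧
      ∀ n, project g (L δ n) ∈ closurePoints g' := by
  by_contra! hcon
  have hκ0 : ℵ₀ < κ := aleph0_lt_aleph_one.trans hκ
  choose Φ hΦ using hcon
  have hΩ : (ℵ₁ : Cardinal.{u}).IsRegular := isRegular_aleph_one
  have hΩT : SmallBounded _ _ := smallBounded_ord hΩ
  -- If guessing fails for every `g`, this builds `ω₁` decreasing clubs, each inside the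
  -- counterexamples `Φ` to its predecessors.
  obtain ⟨G, hG⟩ := exists_rec (Ω := (ℵ₁ : Cardinal.{u}).ord.ToType)
    (fun g h : T → T => (∀ a, g a ≤ h a) ∧ ∀ a, Φ g a ≤ h a) (by
      intro ξ prev
      have : ∀ a, ∃ b, ∀ η, max (prev η a) (Φ (prev η) a) < b := fun a =>
        hT ((mk_Iio_ord_lt ξ).trans hκ) _
      choose h hh using this
      exact ⟨h, fun η => ⟨fun a => ((le_max_left _ _).trans_lt (hh a η)).le,
        fun a => ((le_max_right _ _).trans_lt (hh a η)).le⟩⟩)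
  have hlim : ∀ a, ∃ b, ∀ ξ, G ξ a < b := fun a => hT (by simpa using hκ) _
  choose H hH using hlim
  choose up hup hltup using unbounded_closurePoints hT hκ0 hI H
  obtain ⟨m, -⟩ := hT (ι := PEmpty) (by simpa using aleph0_pos.trans hκ0) PEmpty.elim
  obtain ⟨δ, -, hδ⟩ := exists_ladder hT hκ0 up hltup m
  have hLδ := hL δ ⟨_, hδ⟩
  have hacc : ∀ ξ, IsLimitOf (closurePoints (G ξ)) δ := by
    intro ξ a ha
    obtain ⟨n, hn⟩ := hδ.cofinal a ha
    have h1 := hδ.lt (n + 1)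
    simp only [Function.iterate_succ_apply'] at h1
    exact ⟨_, closurePoints_anti (fun a => (hH a ξ).le) (hup _), hn.trans (hltup _), h1⟩
  -- Projections to shrinking clubs decrease, so by well-foundedness they stabilise; one countable
  -- stage then works for all `n`.
  have hstab : ∀ n, ∃ ξ, ∀ η, ξ ≤ η → project (G η) (L δ n) = project (G ξ) (L δ n) := by
    intro n
    have : Nonempty (ℵ₁ : Cardinal.{u}).ord.ToType := by
      rw [← mk_ne_zero_iff, mk_ord_toType]
      exact hΩ.pos.ne'
    obtain ⟨_, ⟨ξ, rfl⟩, hmin⟩ := wellFounded_lt.has_min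
      (range fun ξ => project (G ξ) (L δ n)) (range_nonempty _)
    refine ⟨ξ, fun η hη => ?_⟩
    rcases hη.eq_or_lt with rfl | hη
    · rfl
    · exact le_antisymm (project_anti (hG ξ η hη).1 _) (not_lt.1 (hmin _ ⟨η, rfl⟩))
  choose s hs using hstab
  obtain ⟨ξ, hξ⟩ := hΩT.countable aleph0_lt_aleph_one s
  -- A stage strictly after `ξ` places the stable values in the club of `Φ (G ξ)`.
  obtain ⟨η, hη⟩ := hΩT.countable aleph0_lt_aleph_one fun _ => ξ
  obtain ⟨n, hn⟩ := hΦ (G ξ) δ hLδ (hacc ξ)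
  apply hn
  rw [hs n ξ (hξ n).le, ← hs n η ((hξ n).trans (hη 0)).le]
  exact closurePoints_anti (hG ξ η (hη 0)).2 (isGreatest_project _ _).1.1

end Guessing

/-! ### The parity tournament -/

section Parity

variable {T : Type u} [LinearOrder T] [WellFoundedLT T]

/-- The parity of the number of elements of `C` up to `a`. -/
def OddBelow (C : Set T) (a : T) : Prop := Odd (C ∩ Iic a).ncard

theorem exists_next {C : Set T} {δ : T} (hfin : ∀ a < δ, (C ∩ Iic a).Finite)
    (hlim : IsLimitOf C δ) {c : T} (hcδ : c < δ) :
    ∃ d ∈ C, c < d ∧ d < δ ∧ (∀ a, c ≤ a → a < d → (C ∩ Iic a).ncard = (C ∩ Iic c).ncard) ∧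
      (C ∩ Iic d).ncard = (C ∩ Iic c).ncard + 1 := by
  obtain ⟨d, ⟨hdC, hcd, hdδ⟩, hmin⟩ := wellFounded_lt.has_min {d | d ∈ C ∧ c < d ∧ d < δ}
    (hlim c hcδ)
  have hgap : ∀ x ∈ C, x < d → x ≤ c := fun x hx hxd => by
    by_contra! h
    exact hmin x ⟨hx, h, hxd.trans hdδ⟩ hxd
  refine ⟨d, hdC, hcd, hdδ, fun a hca had => ?_, ?_⟩
  · congr 1
    ext x
    exact ⟨fun hx => ⟨hx.1, hgap x hx.1 (lt_of_le_of_lt hx.2 had)⟩,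
      fun hx => ⟨hx.1, le_trans hx.2 hca⟩⟩
  · have : C ∩ Iic d = insert d (C ∩ Iic c) := by
      ext x
      constructor
      · rintro ⟨hx, hxd⟩
        rcases (show x ≤ d from hxd).eq_or_lt with rfl | h
        · exact Or.inl rfl
        · exact Or.inr ⟨hx, hgap x hx h⟩
      · rintro (rfl | hx)
        · exact ⟨hdC, le_rfl⟩
        · exact ⟨hx.1, le_trans hx.2 hcd.le⟩
    rw [this, ncard_insert_of_notMem (fun h => absurd h.2 (not_le.2 hcd)) (hfin c hcδ)]

/-- `f` is constantly `i` on an interval below `δ` with end points in `E`. -/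
def ConstOn (f : T → Prop) (i : Prop) (E : Set T) (δ : T) : Prop :=
  ∃ x ∈ E, ∃ y ∈ E, x < y ∧ y ≤ δ ∧ ∀ a, x ≤ a → a < y → (f a ↔ i)

omit [WellFoundedLT T] in
theorem ConstOn.mono {f : T → Prop} {i : Prop} {E E' : Set T} {δ : T} (h : ConstOn f i E δ)
    (hE : E ⊆ E') : ConstOn f i E' δ := by
  obtain ⟨x, hx, y, hy, h⟩ := h
  exact ⟨x, hE hx, y, hE hy, h⟩

/-- The parity is constant between consecutive elements of `C` and flips at the next one, so two
adjacent gaps show both values. -/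
theorem constOn_oddBelow {C E : Set T} {δ : T} (hfin : ∀ a < δ, (C ∩ Iic a).Finite)
    (hlim : IsLimitOf C δ) {m : T} (hm : m < δ) (hCE : C ⊆ E) (i : Prop) :
    ConstOn (OddBelow C) i E δ := by
  obtain ⟨c, hc, -, hcδ⟩ := hlim m hm
  obtain ⟨d, hd, hcd, hdδ, hconst, hsucc⟩ := exists_next hfin hlim hcδ
  obtain ⟨e, he, hde, heδ, hconst', -⟩ := exists_next hfin hlim hdδ
  by_cases h : OddBelow C c ↔ i
  · refine ⟨c, hCE hc, d, hCE hd, hcd, hdδ.le, fun a h1 h2 => ?_⟩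
    rw [← h, OddBelow, OddBelow, hconst a h1 h2]
  · refine ⟨d, hCE hd, e, hCE he, hde, heδ.le, fun a h1 h2 => ?_⟩
    rw [OddBelow, hconst' a h1 h2, hsucc, Nat.odd_add_one]
    rw [OddBelow] at h
    tauto

/-- Every closed unbounded set contains the end points of intervals below some `δ ∈ B` on which
`r · δ` is constant, for both truth values. -/
def Guesses (r : T → T → Prop) (B : Set T) : Prop :=
  ∀ g : T → T, ∃ δ ∈ B, ∀ i : Prop, ConstOn (r · δ) i (closurePoints g) δ

omit [WellFoundedLT T] in
-- The pointwise maximum of two functions has its closure points in both clubs.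
theorem isPositive_guesses [NoMaxOrder T] (r : T → T → Prop) : IsPositive (Guesses r) where
  mono := fun hX hXY g => by
    obtain ⟨δ, hδ, h⟩ := hX g
    exact ⟨δ, hXY hδ, h⟩
  or_of_union := by
    intro X Y h
    by_contra! hcon
    simp only [Guesses] at hcon
    push Not at hcon
    obtain ⟨⟨g₁, h₁⟩, g₂, h₂⟩ := hcon
    obtain ⟨δ, hδ, hc⟩ := h fun a => max (g₁ a) (g₂ a)
    rcases hδ with hδ | hδ
    · obtain ⟨i, hi⟩ := h₁ δ hδ
      exact hi ((hc i).mono (closurePoints_anti fun a => le_max_left _ _))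
    · obtain ⟨i, hi⟩ := h₂ δ hδ
      exact hi ((hc i).mono (closurePoints_anti fun a => le_max_right _ _))
  unbounded := by
    intro X hX x
    obtain ⟨δ, hδ, hc⟩ := hX fun _ => x
    obtain ⟨a, -, b, hb, hab, hbδ, -⟩ := hc True
    exact ⟨δ, hδ, (hb a hab).trans_le hbδ⟩

omit [WellFoundedLT T] in
theorem Guesses.exists_related {r : T → T → Prop} {A B : Set T} (hA : Unbounded A)
    (hB : Guesses r B) (g : T → T) (i : Prop) :
    ∃ a ∈ A, ∃ b ∈ B, a < b ∧ g a < b ∧ (r a b ↔ i) := by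
  choose up hup hlt using hA
  -- Closure of the right end point `y` puts `up x`, an element of `A`, into the interval `[x, y)`
  -- and `g (up x)` below `y`.
  obtain ⟨δ, hδ, hc⟩ := hB fun a => max (up a) (g (up a))
  obtain ⟨x, -, y, hy, hxy, hyδ, hconst⟩ := hc i
  have h := max_lt_iff.1 (hy x hxy)
  exact ⟨up x, hup x, δ, hδ, h.1.trans_le hyδ, h.2.trans_le hyδ, hconst _ (hlt x).le h.1⟩

theorem exists_guesses_univ {κ : Cardinal.{u}} (hT : SmallBounded κ T) (hκ : ℵ₁ < κ)
    (hI : ∀ x : T, #(Iic x) < κ) : ∃ r : T → T → Prop, Guesses r univ := by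
  have hL : ∀ δ : T, ∃ L : ℕ → T, (∃ l, IsLadder l δ) → IsLadder L δ := by
    intro δ
    by_cases h : ∃ l, IsLadder l δ
    · exact ⟨h.choose, fun _ => h.choose_spec⟩
    · exact ⟨fun _ => δ, fun h' => absurd h' h⟩
  choose L hL using hL
  obtain ⟨g, hg⟩ := exists_guessing hT hκ hI L hL
  refine ⟨fun a δ => OddBelow (range fun n => project g (L δ n)) a, fun g' => ?_⟩
  obtain ⟨δ, hLδ, hlim, hmem⟩ := hg g'
  -- Projecting keeps the ladder cofinal because `δ` is a limit of closure points of `g`; hence its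
  -- range has order type `ω`.
  have habove : ∀ a < δ, ∃ k, ∀ n, k ≤ n → a < project g (L δ n) := by
    intro a ha
    obtain ⟨e, he, hae, heδ⟩ := hlim a ha
    obtain ⟨k, hk⟩ := hLδ.cofinal e heδ
    exact ⟨k, fun n hn => hae.trans_le
      ((isGreatest_project g _).2 ⟨he, hk.le.trans (hLδ.mono hn)⟩)⟩
  refine ⟨δ, mem_univ _, fun i => constOn_oddBelow (fun a ha => ?_) (fun a ha => ?_) (hLδ.lt 0)
    (by rintro _ ⟨n, rfl⟩; exact hmem n) i⟩
  · obtain ⟨k, hk⟩ := habove a ha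
    refine ((finite_lt_nat k).image fun n => project g (L δ n)).subset ?_
    rintro _ ⟨⟨n, rfl⟩, hn⟩
    exact ⟨n, not_le.1 fun h => absurd (hk n h) (not_lt.2 hn), rfl⟩
  · obtain ⟨k, hk⟩ := habove a ha
    exact ⟨_, ⟨k, rfl⟩, hk k le_rfl, (isGreatest_project g _).1.2.trans_lt (hLδ.lt k)⟩

omit [WellFoundedLT T] in
-- Fewer than `κ` counterexamples, one per colour, are dominated by one function; the colour of the
-- `δ` guessing it gives a contradiction.
theorem Guesses.exists_fiber {κ : Cardinal.{u}} (hT : SmallBounded κ T) {r : T → T → Prop}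
    (hr : Guesses r univ) {C : Type u} (hC : #C < κ) (c : T → C) :
    ∃ k, Guesses r {v | c v = k} := by
  by_contra! hcon
  simp only [Guesses] at hcon
  push Not at hcon
  choose g hg using hcon
  have hsup : ∀ a, ∃ b, ∀ k, g k a < b := fun a => hT hC _
  choose G hG using hsup
  obtain ⟨δ, -, hδ⟩ := hr G
  obtain ⟨i, hi⟩ := hg (c δ) δ rfl
  exact hi ((hδ i).mono (closurePoints_anti fun a => (hG a _).le))

end Parity

theorem orientsAll_directedCycles {μ : Cardinal.{u}} (hμ : ℵ₀ < μ) :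
    OrientsAll (completeGraphOn (Order.succ μ)) directedCycles μ := by
  have hκ : (Order.succ μ).IsRegular := isRegular_succ hμ.le
  have hT : SmallBounded _ _ := smallBounded_ord hκ
  have hμ1 : ℵ₁ < Order.succ μ := by
    rw [Order.lt_succ_iff, ← succ_aleph0]
    exact Order.succ_le_of_lt hμ
  have := Cardinal.noMaxOrder hκ.aleph0_le
  obtain ⟨r, hr⟩ := exists_guesses_univ hT hμ1 (mk_Iic_ord_lt hκ.aleph0_le)
  refine ⟨tournament r, isOrientation_tournament _, fun C hC c => ?_⟩
  obtain ⟨k, hk⟩ := hr.exists_fiber hT (hC.trans_lt (Order.lt_succ μ)) c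
  refine ⟨k, fun n => embeds_of_isPositive (isPositive_guesses r) (fun A B hA hB g => ?_)
    (fun A B hA hB g => ?_) hk n.2⟩
  · simpa using hB.exists_related hA g True
  · simpa using hB.exists_related hA g False

end DirectedColouring

theorem mainTheorem5 :
    (∀ κ : Cardinal.{u}, κ.IsRegular → DirectedColouring.NotArrowRect κ →
      DirectedColouring.OrientsStronglyAll (DirectedColouring.completeGraphOn κ)
        DirectedColouring.directedCycles) ∧
    (∀ μ : Cardinal.{u}, Cardinal.aleph0 < μ →
      DirectedColouring.OrientsAll (DirectedColouring.completeGraphOn (Order.succ μ))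
        DirectedColouring.directedCycles μ) :=
  ⟨fun _ hκ h => DirectedColouring.orientsStronglyAll_directedCycles hκ h,
    fun _ hμ => DirectedColouring.orientsAll_directedCycles hμ⟩
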